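/- **Proposition.** A random vector $x$ in $\mathbb{R}^n$ has the *convex concentration property* with constant $K>0$ if for every convex function $h:\mathbb{R}^n\to\mathbb{R}$ that is $1$-Lipschitz for the Euclidean norm, $h(x)$ is integrable and $$\mathbb{P}\{|h(x)-\mathbb{E}[h(x)]|\ge t\}\le 2e^{-t^2/(2K^2)}\qquad\text{for all } t>0.$$ Write $\|B\|_{\rm op}$ and $\|B\|_F$ for the (Euclidean) operator norm and the Frobenius norm of a matrix $B$. There is a universal constant $c>2$ that is a constant in the Hanson–Wright inequality, that is, for every $n$, every mean-zero random vector $u$ in $\mathbb{R}^n$ with the convex concentration property with constant $K$, every nonzero $B\in\mathbb{R}^{n\times n}$ and every $t>0$, $$\mathbb{P}\{|u^{\sf T}Bu-\mathbb{E}[u^{\sf T}Bu]|\ge t\}\le 2\exp\Bigl(-\frac1c\min\Bigl(\frac{t^2}{2K^4\|B\|_F^2},\frac{t}{K^2\|B\|_{\rm op}}\Bigr)\Bigr),$$ and for which the following holds. Let $n\ge 1$, let $X\in\mathbb{R}^{n\times p}$ be a fixed matrix, and let $\epsilon$ be a zero-mean random vector in $\mathbb{R}^n$ with positive definite covariance matrix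 $\Sigma=\mathbb{E}[\epsilon\epsilon^{\sf T}]$ such that $\Sigma^{-1/2}\epsilon$ has the convex concentration property with constant at most $\eta$. Let $\|\cdot\|$ be a norm on $\mathbb{R}^p$ with dual norm $\|\theta\|^\star=\sup\{\langle\beta,\theta\rangle:\|\beta\|\le 1\}$, and let $\mathcal{M}\subset\mathbb{R}^{p\times p}$ be a finite set with $$(\|\beta\|^\star)^2=\sup_{A\in\mathcal{M}}\beta^{\sf T}A\beta\qquad\text{for all }\beta\in\mathbb{R}^p.$$ Then, for every $0<p_0<\frac12$, with probability at least $1-2p_0$, $$\Bigl\|\frac1n X^{\sf T}\epsilon\Bigr\|^\star\le\Lambda,\qquad \Lambda=\frac{1}{\sqrt n}\Bigl(\Lambda_0+2\eta^2\max\{\Lambda_2\sqrt{\kappa},\,\Lambda_1\kappa\}\Bigr)^{1/2},$$ where, with $\tilde X=\Sigma^{1/2}X$, $$\Lambda_0=\sup_{A\in\mathcal{M}}\tfrac1n{\sf Tr}(\tilde XA\tilde X^{\sf T}),\quad \Lambda_1=\sup_{A\in\mathcal{M}}\tfrac1n\|\tilde XA\tilde X^{\sf T}\|_{\rm op},\quad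 \Lambda_2=\sup_{A\in\mathcal{M}}\tfrac1n\|\tilde XA\tilde X^{\sf T}\|_F,\quad \kappa=\frac c2\log\frac{|\mathcal{M}|}{p_0}.$$ -/

import Mathlib

open MeasureTheory
open scoped Matrix MatrixOrder

universe u

noncomputable section

/-- The random vector `x` in `ℝⁿ` (Euclidean norm) has the convex concentration property with
constant `K > 0` under the probability measure `P`. -/
def HasConvexConcentration {Ω : Type*} [MeasurableSpace Ω] (P : Measure Ω) {n : ℕ}
    (x : Ω → EuclideanSpace ℝ (Fin n)) (K : ℝ) : Prop :=
  0 < K ∧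
    ∀ h : EuclideanSpace ℝ (Fin n) → ℝ, LipschitzWith 1 h → ConvexOn ℝ Set.univ h →
      Integrable (fun ω => h (x ω)) P ∧
        ∀ t : ℝ, 0 < t →
          P.real {ω | t ≤ |h (x ω) - ∫ ω', h (x ω') ∂P|} ≤ 2 * Real.exp (-(t ^ 2 / (2 * K ^ 2)))

/-- The dual norm `‖θ‖⋆ = sup {⟨β, θ⟩ : ‖β‖ ≤ 1}` of a norm `N` on `ℝᵖ`. -/
def dualNorm {p : ℕ} (N : Seminorm ℝ (Fin p → ℝ)) (θ : Fin p → ℝ) : ℝ :=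
  sSup {r | ∃ β : Fin p → ℝ, N β ≤ 1 ∧ r = β ⬝ᵥ θ}

/-- The second moment matrix `E[ε εᵀ]`, which is the covariance matrix when `ε` has mean zero. -/
def covMatrix {Ω : Type*} [MeasurableSpace Ω] (P : Measure Ω) {n : ℕ}
    (ε : Ω → EuclideanSpace ℝ (Fin n)) : Matrix (Fin n) (Fin n) ℝ :=
  Matrix.of fun i j => ∫ ω, ε ω i * ε ω j ∂P

/-- The operator norm of a square matrix for the Euclidean norm (its largest singular value). -/
def opNorm {n : ℕ} (B : Matrix (Fin n) (Fin n) ℝ) : ℝ :=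
  ‖Matrix.toEuclideanCLM (𝕜 := ℝ) B‖

/-- The Frobenius norm of a square matrix. -/
def frobNorm {n : ℕ} (B : Matrix (Fin n) (Fin n) ℝ) : ℝ :=
  Real.sqrt (∑ i, ∑ j, B i j ^ 2)

/-- The quadratic form `vᵀ B v`. -/
def quadForm {n : ℕ} (B : Matrix (Fin n) (Fin n) ℝ) (v : Fin n → ℝ) : ℝ :=
  v ⬝ᵥ (B *ᵥ v)

/-- `c` is an admissible constant in the Hanson-Wright inequality for random vectors with the
convex concentration property: one number `c` for all dimensions, all random vectors, all `K`,
all matrices and all `t`. (For `B = 0` the event on the left is empty.) -/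
def IsHansonWrightConstant (c : ℝ) : Prop :=
  ∀ (Ω : Type u) [MeasurableSpace Ω] (P : Measure Ω) [IsProbabilityMeasure P] (n : ℕ)
    (v : Ω → EuclideanSpace ℝ (Fin n)) (K : ℝ), Measurable v → (∀ i, ∫ ω, v ω i ∂P = 0) →
    HasConvexConcentration P v K →
    ∀ (B : Matrix (Fin n) (Fin n) ℝ) (t : ℝ), 0 < t →
      P.real {ω | t ≤ |quadForm B (v ω) - ∫ ω', quadForm B (v ω') ∂P|} ≤
        2 * Real.exp (-(1 / c *
          min (t ^ 2 / (2 * K ^ 4 * frobNorm B ^ 2)) (t / (K ^ 2 * opNorm B))))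

/-- `X̃ A X̃ᵀ` with `X̃ = Σ^{1/2} X`. -/
def whitenedForm {n p : ℕ} (S : Matrix (Fin n) (Fin n) ℝ) (X : Matrix (Fin n) (Fin p) ℝ)
    (A : Matrix (Fin p) (Fin p) ℝ) : Matrix (Fin n) (Fin n) ℝ :=
  (CFC.sqrt S * X) * A * (CFC.sqrt S * X)ᵀ

/-- `Λ₀ = sup_{A ∈ M} (1/n) Tr(X̃ A X̃ᵀ)`. -/
def aggTrace {n p : ℕ} (S : Matrix (Fin n) (Fin n) ℝ) (X : Matrix (Fin n) (Fin p) ℝ)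
    (M : Finset (Matrix (Fin p) (Fin p) ℝ)) : ℝ :=
  sSup ((fun A => 1 / (n : ℝ) * (whitenedForm S X A).trace) '' (M : Set _))

/-- `Λ₁ = sup_{A ∈ M} (1/n) ‖X̃ A X̃ᵀ‖_op`. -/
def aggOp {n p : ℕ} (S : Matrix (Fin n) (Fin n) ℝ) (X : Matrix (Fin n) (Fin p) ℝ)
    (M : Finset (Matrix (Fin p) (Fin p) ℝ)) : ℝ :=
  sSup ((fun A => 1 / (n : ℝ) * opNorm (whitenedForm S X A)) '' (M : Set _))

/-- `Λ₂ = sup_{A ∈ M} (1/n) ‖X̃ A X̃ᵀ‖_F`. -/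
def aggFrob {n p : ℕ} (S : Matrix (Fin n) (Fin n) ℝ) (X : Matrix (Fin n) (Fin p) ℝ)
    (M : Finset (Matrix (Fin p) (Fin p) ℝ)) : ℝ :=
  sSup ((fun A => 1 / (n : ℝ) * frobNorm (whitenedForm S X A)) '' (M : Set _))

/-- `κ = (c/2) log(|M| / p₀)`. -/
def logTerm {p : ℕ} (c p₀ : ℝ) (M : Finset (Matrix (Fin p) (Fin p) ℝ)) : ℝ :=
  c / 2 * Real.log ((M.card : ℝ) / p₀)

/-- `Λ = n^{-1/2} (Λ₀ + 2 η² max {Λ₂ √κ, Λ₁ κ})^{1/2}`. -/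
def noiseBound {n p : ℕ} (c η p₀ : ℝ) (S : Matrix (Fin n) (Fin n) ℝ)
    (X : Matrix (Fin n) (Fin p) ℝ) (M : Finset (Matrix (Fin p) (Fin p) ℝ)) : ℝ :=
  1 / Real.sqrt n *
    Real.sqrt (aggTrace S X M + 2 * η ^ 2 *
      max (aggFrob S X M * Real.sqrt (logTerm c p₀ M)) (aggOp S X M * logTerm c p₀ M))

end

/-! The Hanson–Wright inequality comes first. For positive semidefinite `A` with associated operator
`T`, the form `⟪x, T x⟫` is convex but not Lipschitz. It is replaced by `truncatedForm`, the
supremum of its tangents at points with `‖T y‖ ≤ ρ`. That function is convex and `2ρ`-Lipschitz, so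
it concentrates, and it equals the form wherever `‖T x‖ ≤ ρ`. The map `x ↦ ‖T x‖` is itself convex
and Lipschitz, with mean at most `2 K F`, where `F` bounds the Frobenius norm. Hence a suitable `ρ`
makes the exceptional event as rare as required
(`HasConvexConcentration.quadForm_tail_of_posSemidef`).

Since `ρ` depends on the level `t`, so does the centre of concentration.
`tail_around_mean_of_tail_around_centres` shows that all these centres lie close to the mean, at the
price of a constant. A general matrix is symmetrised and split into positive and negative parts,
neither of which has larger norms (`exists_posSemidef_decomposition`).

For the noise bound, `εᵀ X A Xᵀ ε` is the form of `X̃ A X̃ᵀ` at the whitened noise, and its mean is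
a trace. The level in `Λ` makes each `A ∈ M` fail with probability at most `2 p₀ / |M|`, and a union
bound over `M` finishes the proof. -/

/-! ### Tails, means and change of centre -/

/-- A nonnegative random variable with an exponential tail is integrable, with a matching bound
on its expectation. -/
lemma integrable_and_integral_le_of_exp_tail {Ω : Type*} [MeasurableSpace Ω] {P : Measure Ω}
    [IsProbabilityMeasure P] {Z : Ω → ℝ} (hZ : AEMeasurable Z P) (hZ0 : ∀ ω, 0 ≤ Z ω)
    {D b : ℝ} (hD : 0 ≤ D) (hb : 0 < b)
    (h : ∀ t : ℝ, 0 < t → P.real {ω | t ≤ Z ω} ≤ D * Real.exp (-(t / b))) :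
    Integrable Z P ∧ ∫ ω, Z ω ∂P ≤ D * b := by
  have hneg : -(1 / b) < 0 := by have := one_div_pos.mpr hb; linarith
  have hI : IntegrableOn (fun t => D * Real.exp (-(1 / b) * t)) (Set.Ioi 0) :=
    (integrableOn_exp_mul_Ioi hneg 0).const_mul D
  have hval : ∫ t in Set.Ioi (0 : ℝ), D * Real.exp (-(1 / b) * t) = D * b := by
    rw [integral_const_mul, integral_exp_mul_Ioi hneg]
    simp
  have hle : ∫⁻ ω, ENNReal.ofReal (Z ω) ∂P ≤ ENNReal.ofReal (D * b) := by
    -- Layer-cake formula: the expectation is the integral of the tail.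
    rw [lintegral_eq_lintegral_meas_le P (ae_of_all _ hZ0) hZ, ← hval,
      ofReal_integral_eq_lintegral_ofReal hI (ae_of_all _ fun t => by positivity)]
    refine setLIntegral_mono' measurableSet_Ioi fun t ht => ?_
    have h1 := h t ht
    rw [← ofReal_measureReal (measure_ne_top _ _)]
    refine ENNReal.ofReal_le_ofReal (h1.trans_eq ?_)
    congr 2
    ring
  have hint : Integrable Z P := by
    refine ⟨hZ.aestronglyMeasurable, ?_⟩
    rw [hasFiniteIntegral_iff_ofReal (ae_of_all _ hZ0)]
    exact hle.trans_lt ENNReal.ofReal_lt_top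
  refine ⟨hint, ?_⟩
  rw [← ofReal_integral_eq_lintegral_ofReal hint (ae_of_all _ hZ0)] at hle
  exact (ENNReal.ofReal_le_ofReal_iff (by positivity)).mp hle

/-- Two events whose complements have total mass less than one meet. -/
lemma exists_notMem_of_measureReal_add_lt_one {Ω : Type*} [MeasurableSpace Ω] {P : Measure Ω}
    [IsProbabilityMeasure P] {s t : Set Ω} (h : P.real s + P.real t < 1) :
    ∃ ω, ω ∉ s ∧ ω ∉ t := by
  by_contra! hcon
  have huniv : s ∪ t = Set.univ := by
    ext ω
    by_cases hs : ω ∈ s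
    · simp [hs]
    · simp [hcon ω hs]
  have := measureReal_union_le (μ := P) s t
  rw [huniv, probReal_univ] at this
  linarith

lemma four_mul_exp_neg_three_lt : 4 * Real.exp (-3) < 1 / 2 := by
  have h1 : (2 : ℝ) < Real.exp 1 := by have := Real.exp_one_gt_d9; linarith
  have h2 : Real.exp 3 = Real.exp 1 ^ 3 := by rw [← Real.exp_nat_mul]; norm_num
  have h3 : (8 : ℝ) < Real.exp 3 := by
    rw [h2]
    calc (8 : ℝ) = 2 ^ 3 := by norm_num
      _ < _ := by gcongr
  rw [Real.exp_neg, ← div_eq_mul_inv, div_lt_iff₀ (by positivity)]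
  linarith

lemma exp_three_mem : 4 ≤ Real.exp 3 ∧ Real.exp 3 ≤ 21 := by
  have h1 := Real.exp_one_gt_d9
  have h1' := Real.exp_one_lt_d9
  have h2 : Real.exp 3 = Real.exp 1 ^ 3 := by rw [← Real.exp_nat_mul]; norm_num
  rw [h2]
  constructor
  · calc (4 : ℝ) ≤ 2 ^ 3 := by norm_num
      _ ≤ _ := by gcongr; linarith
  · calc Real.exp 1 ^ 3 ≤ 2.75 ^ 3 := by gcongr; linarith
      _ ≤ _ := by norm_num

/-- The Bernstein-type rate `min (t² / a²) (t / b)`. -/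
noncomputable def bernsteinRate (a b t : ℝ) : ℝ := min (t ^ 2 / a ^ 2) (t / b)

/-- Beyond level `a` the quadratic term also exceeds `t / a`, so such a tail is at least exponential
at scale `a`. -/
lemma div_le_bernsteinRate {a b t : ℝ} (hb : 0 < b) (hba : b ≤ a) (ht : a ≤ t) :
    t / a ≤ bernsteinRate a b t := by
  have ha : 0 < a := hb.trans_le hba
  refine le_min ?_ ?_
  · rw [← div_pow]
    have h1 : 1 ≤ t / a := (one_le_div ha).mpr ht
    nlinarith
  · exact div_le_div_of_nonneg_left (by linarith) hb hba

lemma bernsteinRate_div_le {a b t r : ℝ} (hb : 0 ≤ b) (ht : 0 ≤ t) (hr : 1 ≤ r) :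
    bernsteinRate a b t / r ^ 2 ≤ bernsteinRate a b (t / r) := by
  have hr0 : 0 < r := by linarith
  unfold bernsteinRate
  refine le_min ?_ ?_
  · calc _ ≤ t ^ 2 / a ^ 2 / r ^ 2 := by gcongr; exact min_le_left _ _
      _ = _ := by rw [div_pow]; ring
  · calc _ ≤ t / b / r ^ 2 := by gcongr; exact min_le_right _ _
      _ ≤ t / b / r := by
        gcongr
        nlinarith
      _ = _ := by ring

/-- A Bernstein-type tail around level-dependent centres implies such a tail around the mean. -/
lemma tail_around_mean_of_tail_around_centres {Ω : Type*} [MeasurableSpace Ω] {P : Measure Ω}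
    [IsProbabilityMeasure P] {Z : Ω → ℝ} (hZ : Measurable Z) {a b : ℝ} (hb : 0 < b) (hba : b ≤ a)
    (h : ∀ t : ℝ, 0 < t →
      ∃ m : ℝ, P.real {ω | t ≤ |Z ω - m|} ≤ 4 * Real.exp (-bernsteinRate a b t)) :
    Integrable Z P ∧ ∀ t : ℝ, 0 < t →
      P.real {ω | t ≤ |Z ω - ∫ ω', Z ω' ∂P|} ≤
        2 * Real.exp (-(bernsteinRate a b t / 40000)) := by
  have ha : 0 < a := hb.trans_le hba
  have hsmall : ∀ t, 3 * a ≤ t → 4 * Real.exp (-bernsteinRate a b t) < 1 / 2 := by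
    intro t ht
    refine lt_of_le_of_lt ?_ four_mul_exp_neg_three_lt
    have h1 := div_le_bernsteinRate hb hba (by linarith : a ≤ t)
    have h2 : 3 ≤ t / a := (le_div_iff₀ ha).mpr ht
    gcongr
    linarith
  -- The centre at level `3 * a` serves as reference. From this level on, exceptional events have
  -- probability below `1/2`, so any two of them leave a common good point, which ties their centres
  -- together.
  obtain ⟨m, hm⟩ := h (3 * a) (by positivity)
  have hcentre : ∀ t, 3 * a ≤ t →
      P.real {ω | 3 * t ≤ |Z ω - m|} ≤ 4 * Real.exp (-bernsteinRate a b t) := by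
    intro t ht
    obtain ⟨m', hm'⟩ := h t (by linarith)
    obtain ⟨ω₀, h1, h2⟩ := exists_notMem_of_measureReal_add_lt_one (P := P)
      (s := {ω | 3 * a ≤ |Z ω - m|}) (t := {ω | t ≤ |Z ω - m'|})
      (by linarith [hsmall t ht, hsmall (3 * a) le_rfl])
    simp only [Set.mem_ofPred_eq, not_le] at h1 h2
    -- The common point gives `|m - m'| < 3 * a + t ≤ 2 * t`.
    refine (measureReal_mono fun ω hω => ?_).trans hm'
    simp only [Set.mem_ofPred_eq] at hω ⊢
    rw [abs_lt] at h1 h2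
    rcases le_abs.mp hω with h3 | h3
    · exact le_abs.mpr (Or.inl (by linarith))
    · exact le_abs.mpr (Or.inr (by linarith))
  obtain ⟨he4, he21⟩ := exp_three_mem
  -- The prefactor `exp 3` makes the bound trivial for `s ≤ 9 * a`, where `hcentre` says nothing.
  have htail : ∀ s : ℝ, 0 < s →
      P.real {ω | s ≤ |Z ω - m|} ≤ Real.exp 3 * Real.exp (-(s / (3 * a))) := by
    intro s hs
    rcases le_total (9 * a) s with h9 | h9
    · have h1 := hcentre (s / 3) (by linarith)
      rw [mul_div_cancel₀ s (by norm_num : (3 : ℝ) ≠ 0)] at h1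
      refine h1.trans ?_
      have h2 := div_le_bernsteinRate hb hba (by linarith : a ≤ s / 3)
      have h3 : s / (3 * a) = s / 3 / a := by field_simp
      gcongr
      linarith
    · refine measureReal_le_one.trans ?_
      rw [← Real.exp_add, Real.one_le_exp_iff]
      have : s / (3 * a) ≤ 3 := by rw [div_le_iff₀ (by positivity)]; linarith
      linarith
  obtain ⟨hint, hmean⟩ := integrable_and_integral_le_of_exp_tail
    (P := P) (Z := fun ω => |Z ω - m|) (by fun_prop) (fun ω => abs_nonneg _)
    (by positivity) (by positivity : 0 < 3 * a) htail
  have hint' : Integrable (fun ω => Z ω - m) P :=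
    (integrable_norm_iff (hZ.sub_const m).aestronglyMeasurable).mp (by simpa using hint)
  have hZint : Integrable Z P := by
    refine (hint'.add (integrable_const m)).congr (ae_of_all _ fun ω => ?_)
    simp
  -- The tail bound integrates to `exp 3 * (3 * a)`, and `exp 3 ≤ 21`.
  have hdist : |∫ ω, Z ω ∂P - m| ≤ 63 * a := by
    have h1 : ∫ ω, Z ω ∂P - m = ∫ ω, (Z ω - m) ∂P := by
      rw [integral_sub hZint (integrable_const m)]; simp
    rw [h1]
    refine (abs_integral_le_integral_abs).trans (hmean.trans ?_)
    nlinarith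
  refine ⟨hZint, fun t ht => ?_⟩
  have hlog : (1 / 2 : ℝ) < Real.log 2 := by have := Real.log_two_gt_d9; linarith
  have hlog' : Real.log 2 < 1 := by have := Real.log_two_lt_d9; linarith
  -- Since `126 = 2 * 63`, large `t` lets the shift of centre use at most half of `t`. For smaller
  -- `t` the rate is at most `126 ^ 2`, and the divisor `40000` makes the claimed bound at least
  -- `1`.
  rcases le_total (126 * a) t with hbig | hbig
  · have h1 := hcentre (t / 6) (by linarith)
    have hsub : {ω | t ≤ |Z ω - ∫ ω', Z ω' ∂P|} ⊆ {ω | 3 * (t / 6) ≤ |Z ω - m|} := by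
      intro ω hω
      simp only [Set.mem_ofPred_eq] at hω ⊢
      have h2 := abs_sub_le (Z ω) m (∫ ω, Z ω ∂P)
      rw [abs_sub_comm m] at h2
      linarith
    refine (measureReal_mono hsub).trans (h1.trans ?_)
    have h3 := bernsteinRate_div_le (a := a) hb.le ht.le (by norm_num : (1 : ℝ) ≤ 6)
    have h4 : 126 ≤ bernsteinRate a b t :=
      ((le_div_iff₀ ha).mpr hbig).trans (div_le_bernsteinRate hb hba (by linarith))
    have h5 : (4 : ℝ) = 2 * Real.exp (Real.log 2) := by
      rw [Real.exp_log (by norm_num)]; norm_num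
    rw [h5, mul_assoc, ← Real.exp_add]
    gcongr
    linarith
  · refine measureReal_le_one.trans ?_
    have h2 : bernsteinRate a b t ≤ 126 ^ 2 := by
      refine (min_le_left _ _).trans ?_
      rw [← div_pow]
      gcongr
      exact (div_le_iff₀ ha).mpr hbig
    have h5 : (2 : ℝ) = Real.exp (Real.log 2) := by
      rw [Real.exp_log (by norm_num)]
    rw [h5, ← Real.exp_add, Real.one_le_exp_iff]
    linarith

/-! ### Convex concentration with general Lipschitz constants -/

section ConvexConcentration

variable {Ω : Type*} [MeasurableSpace Ω] {P : Measure Ω} {n : ℕ}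
  {v : Ω → EuclideanSpace ℝ (Fin n)} {K : ℝ}

lemma HasConvexConcentration.mono (hv : HasConvexConcentration P v K) {K' : ℝ} (hK : K ≤ K') :
    HasConvexConcentration P v K' := by
  obtain ⟨hK0, h⟩ := hv
  refine ⟨hK0.trans_le hK, fun g hg hgc => ⟨(h g hg hgc).1, fun t ht => ?_⟩⟩
  refine ((h g hg hgc).2 t ht).trans ?_
  gcongr

/-- Convex concentration for convex functions with an arbitrary Lipschitz constant. -/
lemma HasConvexConcentration.lipschitz_tail (hv : HasConvexConcentration P v K)
    {g : EuclideanSpace ℝ (Fin n) → ℝ} {l : ℝ} (hl : 0 < l)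
    (hg : ∀ x y, g x ≤ g y + l * ‖x - y‖) (hgc : ConvexOn ℝ Set.univ g) :
    Integrable (fun ω => g (v ω)) P ∧ ∀ t : ℝ, 0 < t →
      P.real {ω | t ≤ |g (v ω) - ∫ ω', g (v ω') ∂P|} ≤
        2 * Real.exp (-(t ^ 2 / (2 * K ^ 2 * l ^ 2))) := by
  have hlip : LipschitzWith 1 (fun x => l⁻¹ * g x) := by
    refine LipschitzWith.of_le_add_mul 1 fun x y => ?_
    have h1 := mul_le_mul_of_nonneg_left (hg x y) (inv_nonneg.mpr hl.le)
    rw [mul_add, inv_mul_cancel_left₀ hl.ne'] at h1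
    simpa [dist_eq_norm] using h1
  obtain ⟨hint, htail⟩ := hv.2 _ hlip (hgc.smul (inv_nonneg.mpr hl.le))
  refine ⟨by simpa [mul_inv_cancel_left₀ hl.ne'] using hint.const_mul l, fun t ht => ?_⟩
  have h1 := htail (l⁻¹ * t) (by positivity)
  have h2 : {ω | l⁻¹ * t ≤ |l⁻¹ * g (v ω) - ∫ ω', l⁻¹ * g (v ω') ∂P|} =
      {ω | t ≤ |g (v ω) - ∫ ω', g (v ω') ∂P|} := by
    ext ω
    simp only [Set.mem_ofPred_eq]
    rw [integral_const_mul, ← mul_sub, abs_mul, abs_of_pos (inv_pos.mpr hl),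
      mul_le_mul_iff_right₀ (inv_pos.mpr hl)]
  rw [h2] at h1
  refine h1.trans_eq ?_
  congr 3
  field_simp

end ConvexConcentration

/-! ### Lipschitz convex truncation of a quadratic form -/

section Truncation

variable {E : Type*} [NormedAddCommGroup E] [InnerProductSpace ℝ E]

/-- The supremum of the tangents of `x ↦ ⟪x, T x⟫` at the points where `‖T y‖ ≤ ρ`. -/
noncomputable def truncatedForm (T : E →L[ℝ] E) (ρ : ℝ) (x : E) : ℝ :=
  ⨆ y : {y : E // ‖T y‖ ≤ ρ}, (2 * inner ℝ (T y) x - inner ℝ (y : E) (T y))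

variable {T : E →L[ℝ] E} {ρ : ℝ}

/-- The gap between the two sides is `⟪x - y, T (x - y)⟫`. -/
lemma tangent_le_form (hsymm : ∀ x y, inner ℝ (T x) y = inner ℝ x (T y))
    (hpos : ∀ x, 0 ≤ inner ℝ x (T x)) (x y : E) :
    2 * inner ℝ (T y) x - inner ℝ y (T y) ≤ inner ℝ x (T x) := by
  have h := hpos (x - y)
  rw [map_sub, inner_sub_left, inner_sub_right, inner_sub_right, ← hsymm y x,
    real_inner_comm (T y) x] at h
  linarith

lemma bddAbove_tangents (hsymm : ∀ x y, inner ℝ (T x) y = inner ℝ x (T y))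
    (hpos : ∀ x, 0 ≤ inner ℝ x (T x)) (x : E) :
    BddAbove (Set.range fun y : {y : E // ‖T y‖ ≤ ρ} =>
      2 * inner ℝ (T y) x - inner ℝ (y : E) (T y)) := by
  refine ⟨inner ℝ x (T x), ?_⟩
  rintro _ ⟨y, rfl⟩
  exact tangent_le_form hsymm hpos x y

/-- Here the tangent at `x` itself is admissible, and it touches the form at `x`. -/
lemma truncatedForm_eq (hsymm : ∀ x y, inner ℝ (T x) y = inner ℝ x (T y))
    (hpos : ∀ x, 0 ≤ inner ℝ x (T x)) {x : E} (hx : ‖T x‖ ≤ ρ) :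
    truncatedForm T ρ x = inner ℝ x (T x) := by
  have : Nonempty {y : E // ‖T y‖ ≤ ρ} := ⟨⟨x, hx⟩⟩
  refine le_antisymm (ciSup_le fun y => tangent_le_form hsymm hpos x y) ?_
  refine le_trans ?_ (le_ciSup (bddAbove_tangents hsymm hpos x) ⟨x, hx⟩)
  rw [hsymm x x]
  linarith

/-- Each tangent has gradient `2 T y`, of norm at most `2ρ`. Nonnegativity of `ρ` makes `y = 0`
admissible, so the supremum is over a nonempty set. -/
lemma truncatedForm_le_add (hsymm : ∀ x y, inner ℝ (T x) y = inner ℝ x (T y))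
    (hpos : ∀ x, 0 ≤ inner ℝ x (T x)) (hρ : 0 ≤ ρ) (x x' : E) :
    truncatedForm T ρ x ≤ truncatedForm T ρ x' + 2 * ρ * ‖x - x'‖ := by
  have : Nonempty {y : E // ‖T y‖ ≤ ρ} := ⟨⟨0, by simpa using hρ⟩⟩
  refine ciSup_le fun y => ?_
  have h1 := le_ciSup (bddAbove_tangents (ρ := ρ) hsymm hpos x') y
  have h2 := real_inner_le_norm (T (y : E)) (x - x')
  have h3 : ‖T (y : E)‖ * ‖x - x'‖ ≤ ρ * ‖x - x'‖ := by gcongr; exact y.2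
  rw [inner_sub_right] at h2
  simp only [truncatedForm]
  linarith

lemma convexOn_truncatedForm (hsymm : ∀ x y, inner ℝ (T x) y = inner ℝ x (T y))
    (hpos : ∀ x, 0 ≤ inner ℝ x (T x)) (hρ : 0 ≤ ρ) :
    ConvexOn ℝ Set.univ (truncatedForm T ρ) := by
  have : Nonempty {y : E // ‖T y‖ ≤ ρ} := ⟨⟨0, by simpa using hρ⟩⟩
  refine ⟨convex_univ, fun x _ x' _ s r hs hr hsr => ciSup_le fun y => ?_⟩
  have h1 := mul_le_mul_of_nonneg_left
    (le_ciSup (bddAbove_tangents (ρ := ρ) hsymm hpos x) y) hs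
  have h2 := mul_le_mul_of_nonneg_left
    (le_ciSup (bddAbove_tangents (ρ := ρ) hsymm hpos x') y) hr
  simp only [truncatedForm, smul_eq_mul, inner_add_right, real_inner_smul_right]
  have h3 : inner ℝ (y : E) (T y) = s * inner ℝ (y : E) (T y) + r * inner ℝ (y : E) (T y) := by
    rw [← add_mul, hsr, one_mul]
  linarith

end Truncation

/-! ### Operator and Frobenius norms -/

section Matrices

variable {n : ℕ}

lemma frobNorm_nonneg (B : Matrix (Fin n) (Fin n) ℝ) : 0 ≤ frobNorm B := Real.sqrt_nonneg _

lemma frobNorm_sq (B : Matrix (Fin n) (Fin n) ℝ) : frobNorm B ^ 2 = ∑ i, ∑ j, B i j ^ 2 :=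
  Real.sq_sqrt (by positivity)

lemma quadForm_eq_inner (B : Matrix (Fin n) (Fin n) ℝ) (x : EuclideanSpace ℝ (Fin n)) :
    quadForm B x.ofLp = inner ℝ x (Matrix.toEuclideanCLM (𝕜 := ℝ) B x) := by
  rw [EuclideanSpace.inner_eq_star_dotProduct, Matrix.ofLp_toEuclideanCLM, dotProduct_comm]
  simp [quadForm]

lemma norm_toEuclideanCLM_sq (B : Matrix (Fin n) (Fin n) ℝ) (x : EuclideanSpace ℝ (Fin n)) :
    ‖Matrix.toEuclideanCLM (𝕜 := ℝ) B x‖ ^ 2 = ∑ i, (B i ⬝ᵥ x.ofLp) ^ 2 := by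
  rw [EuclideanSpace.real_norm_sq_eq]
  simp [Matrix.ofLp_toEuclideanCLM, Matrix.mulVec]

lemma dotProduct_sq_le (a : Fin n → ℝ) (x : EuclideanSpace ℝ (Fin n)) :
    (a ⬝ᵥ x.ofLp) ^ 2 ≤ (∑ j, a j ^ 2) * ‖x‖ ^ 2 := by
  rw [EuclideanSpace.real_norm_sq_eq]
  exact Finset.sum_mul_sq_le_sq_mul_sq _ _ _

lemma opNorm_le_frobNorm (B : Matrix (Fin n) (Fin n) ℝ) : opNorm B ≤ frobNorm B := by
  refine ContinuousLinearMap.opNorm_le_bound _ (frobNorm_nonneg B) fun x => ?_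
  have hF := frobNorm_nonneg B
  refine (sq_le_sq₀ (norm_nonneg _) (by positivity)).mp ?_
  rw [norm_toEuclideanCLM_sq, mul_pow, frobNorm_sq, Finset.sum_mul]
  exact Finset.sum_le_sum fun i _ => dotProduct_sq_le _ _

lemma opNorm_pos {B : Matrix (Fin n) (Fin n) ℝ} (hB : B ≠ 0) : 0 < opNorm B := by
  rw [opNorm, norm_pos_iff]
  simpa using hB

lemma frobNorm_sq_eq_trace (B : Matrix (Fin n) (Fin n) ℝ) : frobNorm B ^ 2 = (Bᵀ * B).trace := by
  rw [frobNorm_sq, Finset.sum_comm]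
  simp [Matrix.trace, Matrix.mul_apply, sq]

end Matrices

/-! ### Hanson–Wright for positive semidefinite matrices -/

section HansonWright

variable {Ω : Type*} [MeasurableSpace Ω] {P : Measure Ω} [IsProbabilityMeasure P] {n : ℕ}
  {v : Ω → EuclideanSpace ℝ (Fin n)} {K : ℝ}

/-- Second moments of the one-dimensional marginals. -/
lemma HasConvexConcentration.integral_dotProduct_sq_le (hv : HasConvexConcentration P v K)
    (hmeas : Measurable v) (hmean : ∀ i, ∫ ω, v ω i ∂P = 0) (a : Fin n → ℝ) :
    Integrable (fun ω => (a ⬝ᵥ (v ω).ofLp) ^ 2) P ∧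
      ∫ ω, (a ⬝ᵥ (v ω).ofLp) ^ 2 ∂P ≤ 4 * K ^ 2 * ∑ j, a j ^ 2 := by
  have hK := hv.1
  by_cases ha : a = 0
  · subst ha; simp
  have hpos : 0 < ∑ j, a j ^ 2 := by
    obtain ⟨j, hj⟩ := Function.ne_iff.mp ha
    exact Finset.sum_pos' (fun i _ => sq_nonneg _)
      ⟨j, Finset.mem_univ _, by have : a j ≠ 0 := hj; positivity⟩
  set l := Real.sqrt (∑ j, a j ^ 2) with hl
  have hl0 : 0 < l := Real.sqrt_pos.mpr hpos
  have hl2 : l ^ 2 = ∑ j, a j ^ 2 := Real.sq_sqrt hpos.le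
  have hcoord : ∀ i, Integrable (fun ω => v ω i) P := by
    intro i
    refine (hv.lipschitz_tail (g := fun x => x i) one_pos (fun x y => ?_) ?_).1
    · have h1 := PiLp.norm_apply_le (x - y) i
      have h2 := le_abs_self ((x - y) i)
      rw [Real.norm_eq_abs] at h1
      simp only [PiLp.sub_apply] at h1 h2
      linarith
    · exact ⟨convex_univ, fun x _ y _ s r _ _ _ => by simp⟩
  obtain ⟨-, htail⟩ := hv.lipschitz_tail (g := fun x => a ⬝ᵥ x.ofLp) hl0
    (fun x y => by
      have h1 := dotProduct_sq_le a (x - y)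
      rw [← hl2, ← mul_pow] at h1
      have h2 := abs_le_of_sq_le_sq h1 (by positivity)
      have h3 := (abs_le.mp h2).2
      simp only [WithLp.ofLp_sub, dotProduct_sub] at h3
      linarith)
    ⟨convex_univ, fun x _ y _ s r _ _ _ => by simp [dotProduct_add, dotProduct_smul]⟩
  have hzero : ∫ ω, a ⬝ᵥ (v ω).ofLp ∂P = 0 := by
    simp only [dotProduct]
    rw [integral_finsetSum _ fun i _ => (hcoord i).const_mul _]
    simp [integral_const_mul, hmean]
  have hdot : Measurable fun ω => a ⬝ᵥ (v ω).ofLp := by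
    simp only [dotProduct]
    fun_prop
  -- A Gaussian tail of the marginal at `√t` is an exponential tail of its square at `t`.
  have := integrable_and_integral_le_of_exp_tail (P := P)
    (Z := fun ω => (a ⬝ᵥ (v ω).ofLp) ^ 2) (D := 2) (b := 2 * K ^ 2 * l ^ 2)
    (hdot.pow_const 2).aemeasurable (fun ω => sq_nonneg _) (by norm_num) (by positivity)
    (fun t ht => by
      have h1 := htail (Real.sqrt t) (Real.sqrt_pos.mpr ht)
      rw [hzero, Real.sq_sqrt ht.le] at h1
      refine (measureReal_mono fun ω hω => ?_).trans h1
      simp only [Set.mem_ofPred_eq, sub_zero] at hω ⊢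
      rw [← Real.sqrt_sq_eq_abs]
      exact Real.sqrt_le_sqrt hω)
  refine ⟨this.1, this.2.trans_eq ?_⟩
  rw [hl2]; ring

/-- The marginal bounds, summed over the rows of `A`, control the second moment; nonnegativity of
the variance passes to the first. -/
lemma HasConvexConcentration.integral_norm_le (hv : HasConvexConcentration P v K)
    (hmeas : Measurable v) (hmean : ∀ i, ∫ ω, v ω i ∂P = 0) (A : Matrix (Fin n) (Fin n) ℝ) :
    ∫ ω, ‖Matrix.toEuclideanCLM (𝕜 := ℝ) A (v ω)‖ ∂P ≤ 2 * K * frobNorm A := by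
  have hK := hv.1
  have hF := frobNorm_nonneg A
  have hsq : ∫ ω, ‖Matrix.toEuclideanCLM (𝕜 := ℝ) A (v ω)‖ ^ 2 ∂P ≤
      (2 * K * frobNorm A) ^ 2 := by
    simp only [norm_toEuclideanCLM_sq]
    rw [integral_finsetSum _ fun i _ => (hv.integral_dotProduct_sq_le hmeas hmean (A i)).1]
    refine (Finset.sum_le_sum fun i _ =>
      (hv.integral_dotProduct_sq_le hmeas hmean (A i)).2).trans_eq ?_
    rw [← Finset.mul_sum, mul_pow, frobNorm_sq]
    ring
  have hm : Measurable fun ω => ‖Matrix.toEuclideanCLM (𝕜 := ℝ) A (v ω)‖ :=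
    ((Matrix.toEuclideanCLM (𝕜 := ℝ) A).continuous.measurable.comp hmeas).norm
  have hint2 : Integrable (fun ω => ‖Matrix.toEuclideanCLM (𝕜 := ℝ) A (v ω)‖ ^ 2) P := by
    simp only [norm_toEuclideanCLM_sq]
    exact integrable_finsetSum _ fun i _ => (hv.integral_dotProduct_sq_le hmeas hmean (A i)).1
  have hL2 : MemLp (fun ω => ‖Matrix.toEuclideanCLM (𝕜 := ℝ) A (v ω)‖) 2 P :=
    (memLp_two_iff_integrable_sq hm.aestronglyMeasurable).mpr hint2
  have hvar := ProbabilityTheory.variance_nonneg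
    (fun ω => ‖Matrix.toEuclideanCLM (𝕜 := ℝ) A (v ω)‖) P
  rw [ProbabilityTheory.variance_eq_sub hL2] at hvar
  simp only [Pi.pow_apply] at hvar
  exact (abs_le.mp (abs_le_of_sq_le_sq (by linarith) (by positivity))).2

/-- Hanson-Wright for positive semidefinite matrices. -/
lemma HasConvexConcentration.quadForm_tail_of_posSemidef (hv : HasConvexConcentration P v K)
    (hmeas : Measurable v) (hmean : ∀ i, ∫ ω, v ω i ∂P = 0)
    {A : Matrix (Fin n) (Fin n) ℝ} (hA : A.PosSemidef) {F o : ℝ} (ho : 0 < o) (hoF : o ≤ F)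
    (hAF : frobNorm A ≤ F) (hAo : opNorm A ≤ o) :
    Integrable (fun ω => quadForm A (v ω).ofLp) P ∧ ∀ t : ℝ, 0 < t →
      P.real {ω | t ≤ |quadForm A (v ω).ofLp - ∫ ω', quadForm A (v ω').ofLp ∂P|} ≤
        2 * Real.exp (-(bernsteinRate (32 * K ^ 2 * F) (32 * K ^ 2 * o) t / 40000)) := by
  have hK := hv.1
  have hF : 0 < F := ho.trans_le hoF
  set T := Matrix.toEuclideanCLM (𝕜 := ℝ) A with hT
  have hsymm : ∀ x y, inner ℝ (T x) y = inner ℝ x (T y) := by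
    intro x y
    rw [← ContinuousLinearMap.adjoint_inner_right, ← ContinuousLinearMap.star_eq_adjoint, hT,
      ← map_star, Matrix.star_eq_conjTranspose, hA.isHermitian.eq]
  have hpos : ∀ x, 0 ≤ inner ℝ x (T x) := by
    intro x
    rw [← quadForm_eq_inner]
    have := hA.dotProduct_mulVec_nonneg x.ofLp
    simpa [quadForm] using this
  simp only [quadForm_eq_inner]
  refine tail_around_mean_of_tail_around_centres (Z := fun ω => inner ℝ (v ω) (T (v ω)))
    (by fun_prop) (by positivity) (by gcongr) fun t ht => ?_
  -- The first term covers the mean of `‖T v‖`. The second is a deviation whose probability is at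
  -- most `2 * exp (-t / (2 K² o))`, matching the linear regime.
  set ρ := 2 * K * F + Real.sqrt (o * t) with hρ
  have hρ0 : 0 < ρ := by positivity
  have hg := (hv.lipschitz_tail (g := fun x => ‖T x‖) ho (fun x y => by
      have h1 : ‖T x‖ ≤ ‖T y‖ + ‖T (x - y)‖ := by
        rw [map_sub]
        have := norm_add_le (T y) (T x - T y)
        simpa using this
      have h2 : ‖T (x - y)‖ ≤ o * ‖x - y‖ := (T.le_opNorm _).trans (by gcongr; exact hAo)
      linarith)
    (convexOn_univ_norm.comp_linearMap T.toLinearMap)).2 (Real.sqrt (o * t)) (by positivity)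
  have hf := (hv.lipschitz_tail (g := truncatedForm T ρ) (l := 2 * ρ) (by positivity)
    (truncatedForm_le_add hsymm hpos hρ0.le) (convexOn_truncatedForm hsymm hpos hρ0.le)).2 t ht
  set m := ∫ ω, truncatedForm T ρ (v ω) ∂P with hm
  have hmeanT : ∫ ω, ‖T (v ω)‖ ∂P ≤ 2 * K * F :=
    (hv.integral_norm_le hmeas hmean A).trans (by gcongr)
  refine ⟨m, ?_⟩
  have hsub : {ω | t ≤ |inner ℝ (v ω) (T (v ω)) - m|} ⊆
      {ω | Real.sqrt (o * t) ≤ |‖T (v ω)‖ - ∫ ω', ‖T (v ω')‖ ∂P|} ∪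
        {ω | t ≤ |truncatedForm T ρ (v ω) - m|} := by
    intro ω hω
    by_cases hx : ‖T (v ω)‖ ≤ ρ
    · right
      simpa only [Set.mem_ofPred_eq, truncatedForm_eq hsymm hpos hx] using hω
    · left
      simp only [Set.mem_ofPred_eq]
      refine le_trans ?_ (le_abs_self _)
      linarith
  refine (measureReal_mono hsub).trans ((measureReal_union_le _ _).trans ?_)
  have hr1 : bernsteinRate (32 * K ^ 2 * F) (32 * K ^ 2 * o) t ≤
      Real.sqrt (o * t) ^ 2 / (2 * K ^ 2 * o ^ 2) := by
    refine (min_le_right _ _).trans ?_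
    rw [Real.sq_sqrt (by positivity), div_le_div_iff₀ (by positivity) (by positivity)]
    have : 0 < t * K ^ 2 * o ^ 2 := by positivity
    linarith
  have hρ2 : ρ ^ 2 ≤ 8 * K ^ 2 * F ^ 2 + 2 * (o * t) := by
    have h1 := Real.sq_sqrt (by positivity : 0 ≤ o * t)
    nlinarith [sq_nonneg (2 * K * F - Real.sqrt (o * t))]
  have hr2 : bernsteinRate (32 * K ^ 2 * F) (32 * K ^ 2 * o) t ≤
      t ^ 2 / (2 * K ^ 2 * (2 * ρ) ^ 2) := by
    have hden : 2 * K ^ 2 * (2 * ρ) ^ 2 ≤ 64 * K ^ 4 * F ^ 2 + 16 * K ^ 2 * o * t := by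
      have := mul_le_mul_of_nonneg_left hρ2 (by positivity : 0 ≤ 8 * K ^ 2)
      linarith
    refine le_trans ?_ (div_le_div_of_nonneg_left (by positivity) (by positivity) hden)
    -- The dominant term of `ρ ^ 2` decides the regime: linear if `o * t` is large, quadratic
    -- otherwise. The linear case fixes the factor `32`.
    rcases le_total (4 * K ^ 2 * F ^ 2) (o * t) with hc | hc
    · refine (min_le_right _ _).trans ?_
      rw [div_le_div_iff₀ (by positivity) (by positivity)]
      have h1 := mul_le_mul_of_nonneg_left hc (by positivity : 0 ≤ 16 * K ^ 2 * t)
      nlinarith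
    · refine (min_le_left _ _).trans ?_
      refine div_le_div_of_nonneg_left (by positivity) (by positivity) ?_
      have h1 := mul_le_mul_of_nonneg_left hc (by positivity : 0 ≤ 16 * K ^ 2)
      have h2 : 0 < K ^ 4 * F ^ 2 := by positivity
      nlinarith
  have e1 := Real.exp_le_exp.mpr (neg_le_neg hr1)
  have e2 := Real.exp_le_exp.mpr (neg_le_neg hr2)
  linarith

end HansonWright

/-! ### Symmetrisation and orthogonal parts -/

section Decomposition

variable {n : ℕ}

/-- The symmetric part of a square matrix. -/
noncomputable def symmPart (B : Matrix (Fin n) (Fin n) ℝ) : Matrix (Fin n) (Fin n) ℝ :=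
  (1 / 2 : ℝ) • (B + Bᵀ)

lemma symmPart_isHermitian (B : Matrix (Fin n) (Fin n) ℝ) : (symmPart B).IsHermitian := by
  ext i j
  simp [symmPart, mul_add, add_comm]

lemma quadForm_symmPart (B : Matrix (Fin n) (Fin n) ℝ) (x : Fin n → ℝ) :
    quadForm (symmPart B) x = quadForm B x := by
  have h : x ⬝ᵥ (Bᵀ *ᵥ x) = x ⬝ᵥ (B *ᵥ x) := by
    rw [Matrix.mulVec_transpose, dotProduct_comm, ← Matrix.dotProduct_mulVec]
  simp only [quadForm, symmPart, Matrix.smul_mulVec, Matrix.add_mulVec, dotProduct_smul,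
    dotProduct_add, h, smul_eq_mul]
  ring

lemma opNorm_transpose (B : Matrix (Fin n) (Fin n) ℝ) : opNorm Bᵀ = opNorm B := by
  have h : Bᵀ = star B := by
    rw [Matrix.star_eq_conjTranspose, Matrix.conjTranspose_eq_transpose_of_trivial]
  rw [opNorm, h, map_star, ContinuousLinearMap.star_eq_adjoint, LinearIsometryEquiv.norm_map, opNorm]

lemma opNorm_symmPart_le (B : Matrix (Fin n) (Fin n) ℝ) : opNorm (symmPart B) ≤ opNorm B := by
  have h := norm_add_le (Matrix.toEuclideanCLM (𝕜 := ℝ) B) (Matrix.toEuclideanCLM (𝕜 := ℝ) Bᵀ)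
  have h' := opNorm_transpose B
  unfold opNorm at h' ⊢
  rw [symmPart, map_smul, norm_smul, map_add]
  norm_num
  linarith

lemma frobNorm_symmPart_le (B : Matrix (Fin n) (Fin n) ℝ) :
    frobNorm (symmPart B) ≤ frobNorm B := by
  refine (sq_le_sq₀ (frobNorm_nonneg _) (frobNorm_nonneg _)).mp ?_
  rw [frobNorm_sq, frobNorm_sq]
  have h1 : ∑ i, ∑ j, B j i ^ 2 = ∑ i, ∑ j, B i j ^ 2 := Finset.sum_comm
  calc ∑ i, ∑ j, symmPart B i j ^ 2 ≤ ∑ i, ∑ j, (1 / 2 * B i j ^ 2 + 1 / 2 * B j i ^ 2) := by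
        refine Finset.sum_le_sum fun i _ => Finset.sum_le_sum fun j _ => ?_
        simp only [symmPart, Matrix.smul_apply, Matrix.add_apply, Matrix.transpose_apply,
          smul_eq_mul]
        nlinarith [sq_nonneg (B i j - B j i)]
    _ = ∑ i, ∑ j, B i j ^ 2 := by
        simp only [Finset.sum_add_distrib, ← Finset.mul_sum, h1]
        ring

/-- For a difference of symmetric matrices with product zero, both norms dominate those of the
parts. -/
lemma norms_le_of_mul_eq_zero {Q R : Matrix (Fin n) (Fin n) ℝ} (hQ : Qᵀ = Q) (hR : Rᵀ = R)
    (hQR : Q * R = 0) :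
    frobNorm Q ≤ frobNorm (Q - R) ∧ frobNorm R ≤ frobNorm (Q - R) ∧
      opNorm Q ≤ opNorm (Q - R) ∧ opNorm R ≤ opNorm (Q - R) := by
  have hRQ : R * Q = 0 := by
    have := congrArg Matrix.transpose hQR
    rwa [Matrix.transpose_mul, hQ, hR, Matrix.transpose_zero] at this
  -- The ranges of `Q` and `R` are orthogonal, so Pythagoras holds both for the Frobenius norm and
  -- pointwise for the images of vectors.
  have hF : frobNorm (Q - R) ^ 2 = frobNorm Q ^ 2 + frobNorm R ^ 2 := by
    simp only [frobNorm_sq_eq_trace, Matrix.transpose_sub, hQ, hR, sub_mul, mul_sub, hQR, hRQ,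
      Matrix.trace_sub, Matrix.trace_zero]
    ring
  have hN : ∀ x, ‖Matrix.toEuclideanCLM (𝕜 := ℝ) (Q - R) x‖ ^ 2 =
      ‖Matrix.toEuclideanCLM (𝕜 := ℝ) Q x‖ ^ 2 + ‖Matrix.toEuclideanCLM (𝕜 := ℝ) R x‖ ^ 2 := by
    intro x
    have h0 : inner ℝ (Matrix.toEuclideanCLM (𝕜 := ℝ) Q x) (Matrix.toEuclideanCLM (𝕜 := ℝ) R x)
        = 0 := by
      rw [← ContinuousLinearMap.adjoint_inner_right, ← ContinuousLinearMap.star_eq_adjoint,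
        ← map_star, Matrix.star_eq_conjTranspose, Matrix.conjTranspose_eq_transpose_of_trivial,
        hQ, ← mul_apply_eq_comp, ← map_mul, hQR]
      simp
    rw [map_sub, sub_apply, norm_sub_sq_real, h0]
    ring
  refine ⟨(sq_le_sq₀ (frobNorm_nonneg _) (frobNorm_nonneg _)).mp (by nlinarith),
    (sq_le_sq₀ (frobNorm_nonneg _) (frobNorm_nonneg _)).mp (by nlinarith),
    ContinuousLinearMap.opNorm_le_bound _ (norm_nonneg _) fun x => ?_,
    ContinuousLinearMap.opNorm_le_bound _ (norm_nonneg _) fun x => ?_⟩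
  all_goals
    refine le_trans ?_ (ContinuousLinearMap.le_opNorm _ x)
    refine (sq_le_sq₀ (norm_nonneg _) (norm_nonneg _)).mp ?_
    rw [hN]
    nlinarith [sq_nonneg ‖Matrix.toEuclideanCLM (𝕜 := ℝ) Q x‖,
      sq_nonneg ‖Matrix.toEuclideanCLM (𝕜 := ℝ) R x‖]

end Decomposition

/-! ### Hanson–Wright for arbitrary matrices -/

section HansonWright

variable {Ω : Type*} [MeasurableSpace Ω] {P : Measure Ω} [IsProbabilityMeasure P] {n : ℕ}
  {v : Ω → EuclideanSpace ℝ (Fin n)} {K : ℝ}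

/-- A square matrix is, as a quadratic form, a difference of positive semidefinite matrices with
no larger norms. -/
lemma exists_posSemidef_decomposition (B : Matrix (Fin n) (Fin n) ℝ) :
    ∃ Q R : Matrix (Fin n) (Fin n) ℝ, Q.PosSemidef ∧ R.PosSemidef ∧
      (∀ x, quadForm B x = quadForm Q x - quadForm R x) ∧
      frobNorm Q ≤ frobNorm B ∧ frobNorm R ≤ frobNorm B ∧
      opNorm Q ≤ opNorm B ∧ opNorm R ≤ opNorm B := by
  have hS : IsSelfAdjoint (symmPart B) := symmPart_isHermitian B
  have hQ := Matrix.nonneg_iff_posSemidef.mp (CFC.posPart_nonneg (symmPart B))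
  have hR := Matrix.nonneg_iff_posSemidef.mp (CFC.negPart_nonneg (symmPart B))
  have hQt : (symmPart B)⁺ᵀ = (symmPart B)⁺ := by
    rw [← Matrix.conjTranspose_eq_transpose_of_trivial]; exact hQ.isHermitian
  have hRt : (symmPart B)⁻ᵀ = (symmPart B)⁻ := by
    rw [← Matrix.conjTranspose_eq_transpose_of_trivial]; exact hR.isHermitian
  have hdiff := CFC.posPart_sub_negPart (symmPart B) hS
  obtain ⟨h1, h2, h3, h4⟩ :=
    norms_le_of_mul_eq_zero hQt hRt (CFC.posPart_mul_negPart (symmPart B))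
  rw [hdiff] at h1 h2 h3 h4
  refine ⟨_, _, hQ, hR, fun x => ?_, h1.trans (frobNorm_symmPart_le B),
    h2.trans (frobNorm_symmPart_le B), h3.trans (opNorm_symmPart_le B),
    h4.trans (opNorm_symmPart_le B)⟩
  rw [← quadForm_symmPart]
  conv_lhs => rw [← hdiff]
  simp only [quadForm, Matrix.sub_mulVec, dotProduct_sub]

/-- The constant is `40000 * 4 * 2 * 512`: change of centre, halving of `t` between the two parts,
reduction of the prefactor from `4` to `2`, and rescaling of the rate. -/
theorem isHansonWrightConstant_163840000 : IsHansonWrightConstant.{u} 163840000 := by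
  intro Ω _ P _ n v K hmeas hmean hv B t ht
  have hK := hv.1
  by_cases hB : B = 0
  · subst hB
    have h0 : {ω | t ≤ |quadForm (0 : Matrix (Fin n) (Fin n) ℝ) (v ω).ofLp -
        ∫ ω', quadForm (0 : Matrix (Fin n) (Fin n) ℝ) (v ω').ofLp ∂P|} = ∅ := by
      ext ω
      simp [quadForm, ht]
    rw [h0, measureReal_empty]
    positivity
  have ho := opNorm_pos hB
  have hoF := opNorm_le_frobNorm B
  have hF : 0 < frobNorm B := ho.trans_le hoF
  obtain ⟨Q, R, hQ, hR, hquad, hQF, hRF, hQo, hRo⟩ := exists_posSemidef_decomposition B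
  -- Using the norms of `B` as bounds gives both parts the same rate, and positive bounds even if
  -- one part vanishes.
  obtain ⟨hQi, hQt⟩ := hv.quadForm_tail_of_posSemidef hmeas hmean hQ ho hoF hQF hQo
  obtain ⟨hRi, hRt⟩ := hv.quadForm_tail_of_posSemidef hmeas hmean hR ho hoF hRF hRo
  simp only [hquad]
  rw [integral_sub hQi hRi]
  set mQ := ∫ ω, quadForm Q (v ω).ofLp ∂P
  set mR := ∫ ω, quadForm R (v ω).ofLp ∂P
  set F := frobNorm B
  set o := opNorm B
  set r := bernsteinRate (32 * K ^ 2 * F) (32 * K ^ 2 * o) t with hr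
  have hsub : {ω | t ≤ |quadForm Q (v ω).ofLp - quadForm R (v ω).ofLp - (mQ - mR)|} ⊆
      {ω | t / 2 ≤ |quadForm Q (v ω).ofLp - mQ|} ∪
        {ω | t / 2 ≤ |quadForm R (v ω).ofLp - mR|} := by
    intro ω hω
    by_contra hcon
    simp only [Set.mem_union, Set.mem_ofPred_eq, not_or, not_le] at hcon hω
    have h1 := abs_sub (quadForm Q (v ω).ofLp - mQ) (quadForm R (v ω).ofLp - mR)
    rw [sub_sub_sub_comm] at hω
    linarith [hcon.1, hcon.2]
  have hhalf : r / 2 ^ 2 ≤ bernsteinRate (32 * K ^ 2 * F) (32 * K ^ 2 * o) (t / 2) :=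
    bernsteinRate_div_le (by positivity) ht.le one_le_two
  have hbound : P.real {ω | t ≤ |quadForm Q (v ω).ofLp - quadForm R (v ω).ofLp - (mQ - mR)|} ≤
      4 * Real.exp (-(r / 160000)) := by
    refine (measureReal_mono hsub).trans ((measureReal_union_le _ _).trans ?_)
    have e := Real.exp_le_exp.mpr (by linarith :
      -(bernsteinRate (32 * K ^ 2 * F) (32 * K ^ 2 * o) (t / 2) / 40000) ≤ -(r / 160000))
    linarith [hQt (t / 2) (by positivity), hRt (t / 2) (by positivity)]
  have hweak : P.real {ω | t ≤ |quadForm Q (v ω).ofLp - quadForm R (v ω).ofLp - (mQ - mR)|} ≤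
      2 * Real.exp (-(r / 320000)) := by
    have hsq : Real.exp (-(r / 160000)) = Real.exp (-(r / 320000)) ^ 2 := by
      rw [← Real.exp_nat_mul]; congr 1; push_cast; ring
    have hpos := Real.exp_pos (-(r / 320000))
    -- With `e` this exponential, `4 e² ≤ 2 e` when `e ≤ 1/2`; otherwise `2 e ≥ 1`.
    rcases le_total (Real.exp (-(r / 320000))) (1 / 2) with hc | hc
    · rw [hsq] at hbound
      nlinarith
    · exact measureReal_le_one.trans (by linarith)
  refine hweak.trans ?_
  -- The quadratic terms differ by `32 ^ 2 / 2 = 512`, the linear ones only by `32`.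
  have hrate : min (t ^ 2 / (2 * K ^ 4 * F ^ 2)) (t / (K ^ 2 * o)) / 512 ≤ r := by
    refine le_min ?_ ?_
    · calc _ ≤ t ^ 2 / (2 * K ^ 4 * F ^ 2) / 512 := by gcongr; exact min_le_left _ _
        _ = _ := by field_simp; norm_num
    · calc _ ≤ t / (K ^ 2 * o) / 512 := by gcongr; exact min_le_right _ _
        _ ≤ t / (K ^ 2 * o) / 32 := by gcongr; norm_num
        _ = _ := by field_simp
  gcongr
  linarith

end HansonWright

/-! ### Whitening the noise -/

section Whitening

variable {n p : ℕ} {S : Matrix (Fin n) (Fin n) ℝ}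

lemma sqrt_transpose (S : Matrix (Fin n) (Fin n) ℝ) : (CFC.sqrt S)ᵀ = CFC.sqrt S := by
  rw [← Matrix.conjTranspose_eq_transpose_of_trivial]
  exact (Matrix.nonneg_iff_posSemidef.mp (CFC.sqrt_nonneg S)).isHermitian

lemma sqrt_mul_sqrt (hS : S.PosDef) : CFC.sqrt S * CFC.sqrt S = S :=
  CFC.sqrt_mul_sqrt_self S (Matrix.nonneg_iff_posSemidef.mpr hS.posSemidef)

lemma isUnit_det_sqrt (hS : S.PosDef) : IsUnit (CFC.sqrt S).det := by
  have h := hS.det_pos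
  rw [← sqrt_mul_sqrt hS, Matrix.det_mul] at h
  exact isUnit_iff_ne_zero.mpr fun h0 => by simp [h0] at h

/-- The whitened quadratic form at the whitened vector is the original one. -/
lemma quadForm_whitenedForm (hS : S.PosDef) (X : Matrix (Fin n) (Fin p) ℝ)
    (A : Matrix (Fin p) (Fin p) ℝ) (x : Fin n → ℝ) :
    quadForm (whitenedForm S X A) ((CFC.sqrt S)⁻¹ *ᵥ x) = quadForm A (Xᵀ *ᵥ x) := by
  have h1 : (CFC.sqrt S * X)ᵀ *ᵥ ((CFC.sqrt S)⁻¹ *ᵥ x) = Xᵀ *ᵥ x := by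
    rw [Matrix.transpose_mul, sqrt_transpose, Matrix.mulVec_mulVec, Matrix.mul_assoc,
      Matrix.mul_nonsing_inv _ (isUnit_det_sqrt hS), Matrix.mul_one]
  have h2 : ((CFC.sqrt S)⁻¹ *ᵥ x) ᵥ* (CFC.sqrt S * X) = Xᵀ *ᵥ x := by
    rw [← h1, Matrix.mulVec_transpose]
  rw [quadForm, whitenedForm, ← Matrix.mulVec_mulVec, h1, ← Matrix.mulVec_mulVec,
    Matrix.dotProduct_mulVec, h2, quadForm]

lemma trace_whitenedForm (hS : S.PosDef) (X : Matrix (Fin n) (Fin p) ℝ)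
    (A : Matrix (Fin p) (Fin p) ℝ) :
    (whitenedForm S X A).trace = (X * A * Xᵀ * S).trace := by
  have h : whitenedForm S X A = CFC.sqrt S * (X * A * Xᵀ * CFC.sqrt S) := by
    simp only [whitenedForm, Matrix.transpose_mul, sqrt_transpose, Matrix.mul_assoc]
  rw [h, Matrix.trace_mul_comm, Matrix.mul_assoc, sqrt_mul_sqrt hS]

lemma quadForm_transpose_mulVec (X : Matrix (Fin n) (Fin p) ℝ)
    (A : Matrix (Fin p) (Fin p) ℝ) (x : Fin n → ℝ) :
    quadForm A (Xᵀ *ᵥ x) = quadForm (X * A * Xᵀ) x := by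
  rw [quadForm, quadForm, ← Matrix.mulVec_mulVec, ← Matrix.mulVec_mulVec,
    Matrix.dotProduct_mulVec x X, Matrix.mulVec_transpose]

lemma quadForm_smul (A : Matrix (Fin p) (Fin p) ℝ) (r : ℝ) (x : Fin p → ℝ) :
    quadForm A (r • x) = r ^ 2 * quadForm A x := by
  simp only [quadForm, Matrix.mulVec_smul, dotProduct_smul, smul_dotProduct, smul_eq_mul]
  ring

end Whitening

/-! ### Expectations, the deviation level and the union bound -/

lemma integral_quadForm_eq_trace {Ω : Type*} [MeasurableSpace Ω] {P : Measure Ω} {n : ℕ}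
    {ε : Ω → EuclideanSpace ℝ (Fin n)} (hε : ∀ i, MemLp (fun ω => ε ω i) 2 P)
    (Y : Matrix (Fin n) (Fin n) ℝ) :
    ∫ ω, quadForm Y (ε ω).ofLp ∂P = (Y * covMatrix P ε).trace := by
  have hint : ∀ i j, Integrable (fun ω => ε ω i * (Y i j * ε ω j)) P := fun i j =>
    (((hε i).integrable_mul (hε j)).const_mul (Y i j)).congr
      (ae_of_all _ fun ω => by simp only [Pi.mul_apply]; ring)
  simp only [quadForm, dotProduct, Matrix.mulVec, Finset.mul_sum]
  rw [integral_finsetSum _ fun i _ => integrable_finsetSum _ fun j _ => hint i j]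
  simp only [Matrix.trace, Matrix.diag_apply, Matrix.mul_apply]
  refine Finset.sum_congr rfl fun i _ => ?_
  rw [integral_finsetSum _ fun j _ => hint i j]
  refine Finset.sum_congr rfl fun j _ => ?_
  rw [covMatrix, Matrix.of_apply, ← integral_const_mul]
  exact integral_congr_ae (ae_of_all _ fun ω => by ring)

/-- The upper deviation of a quadratic form at the level `2 η² max (‖W‖_F √κ) (‖W‖_op κ)`. -/
lemma IsHansonWrightConstant.upper_deviation {c : ℝ} (hc : 0 < c)
    (hHW : IsHansonWrightConstant.{u} c) {Ω : Type u} [MeasurableSpace Ω] {P : Measure Ω}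
    [IsProbabilityMeasure P] {n : ℕ} {v : Ω → EuclideanSpace ℝ (Fin n)} {η : ℝ}
    (hmeas : Measurable v) (hmean : ∀ i, ∫ ω, v ω i ∂P = 0)
    (hv : HasConvexConcentration P v η) (W : Matrix (Fin n) (Fin n) ℝ) {κ : ℝ} (hκ : 0 < κ) :
    P.real {ω | ∫ ω', quadForm W (v ω').ofLp ∂P +
        2 * η ^ 2 * max (frobNorm W * Real.sqrt κ) (opNorm W * κ) < quadForm W (v ω).ofLp} ≤
      2 * Real.exp (-(1 / c * (2 * κ))) := by
  have hη := hv.1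
  -- For `W = 0` the level is zero, which Hanson–Wright excludes, but the strict inequality makes
  -- the event empty.
  by_cases hW : W = 0
  · subst hW
    have h0 : {ω | ∫ ω', quadForm (0 : Matrix (Fin n) (Fin n) ℝ) (v ω').ofLp ∂P +
        2 * η ^ 2 * max (frobNorm (0 : Matrix (Fin n) (Fin n) ℝ) * Real.sqrt κ)
          (opNorm (0 : Matrix (Fin n) (Fin n) ℝ) * κ) <
        quadForm (0 : Matrix (Fin n) (Fin n) ℝ) (v ω).ofLp} = ∅ := by
      ext ω
      simp [quadForm, frobNorm, opNorm]
    rw [h0, measureReal_empty]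
    positivity
  have ho := opNorm_pos hW
  have hF := ho.trans_le (opNorm_le_frobNorm W)
  set F := frobNorm W
  set o := opNorm W
  set t := 2 * η ^ 2 * max (F * Real.sqrt κ) (o * κ) with ht
  have ht1 : 2 * η ^ 2 * (F * Real.sqrt κ) ≤ t := by rw [ht]; gcongr; exact le_max_left _ _
  have ht2 : 2 * η ^ 2 * (o * κ) ≤ t := by rw [ht]; gcongr; exact le_max_right _ _
  have ht0 : 0 < t := lt_of_lt_of_le (by positivity) ht2
  refine (measureReal_mono fun ω hω => ?_).trans
    ((hHW Ω P n v η hmeas hmean hv W t ht0).trans ?_)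
  · simp only [Set.mem_ofPred_eq] at hω ⊢
    exact le_trans (by linarith) (le_abs_self _)
  · gcongr
    -- Each entry of the maximum defining `t` makes one term of the rate at least `2 * κ`.
    refine le_min ?_ ?_
    · rw [le_div_iff₀ (by positivity)]
      calc 2 * κ * (2 * η ^ 4 * F ^ 2) = (2 * η ^ 2 * (F * Real.sqrt κ)) ^ 2 := by
            simp only [mul_pow, Real.sq_sqrt hκ.le]; ring
        _ ≤ t ^ 2 := by gcongr
    · rw [le_div_iff₀ (by positivity)]
      linarith

lemma le_sSup_image_finset {α : Type*} (M : Finset α) (f : α → ℝ) {A : α} (hA : A ∈ M) :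
    f A ≤ sSup (f '' (M : Set α)) :=
  le_csSup (M.finite_toSet.image f).bddAbove ⟨A, hA, rfl⟩

/-- Whitened deviation bounds for all `A ∈ M` control the dual norm by `noiseBound`. -/
lemma dualNorm_le_noiseBound {n p : ℕ} (hn : 0 < n) {N : Seminorm ℝ (Fin p → ℝ)}
    {M : Finset (Matrix (Fin p) (Fin p) ℝ)} {S : Matrix (Fin n) (Fin n) ℝ}
    {X : Matrix (Fin n) (Fin p) ℝ} {c η p₀ : ℝ} (hκ : 0 ≤ logTerm c p₀ M) {x : Fin n → ℝ}
    (hM : ∀ β : Fin p → ℝ, IsLUB ((fun A => quadForm A β) '' (M : Set _)) (dualNorm N β ^ 2))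
    (h : ∀ A ∈ M, quadForm A (Xᵀ *ᵥ x) ≤ (whitenedForm S X A).trace +
      2 * η ^ 2 * max (frobNorm (whitenedForm S X A) * Real.sqrt (logTerm c p₀ M))
        (opNorm (whitenedForm S X A) * logTerm c p₀ M)) :
    dualNorm N ((1 / (n : ℝ)) • (Xᵀ *ᵥ x)) ≤ noiseBound c η p₀ S X M := by
  have hn0 : (0 : ℝ) < n := Nat.cast_pos.mpr hn
  set κ := logTerm c p₀ M with hκdef
  set T := aggTrace S X M + 2 * η ^ 2 *
      max (aggFrob S X M * Real.sqrt κ) (aggOp S X M * κ) with hT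
  have hnb : noiseBound c η p₀ S X M = Real.sqrt (1 / n * T) := by
    rw [noiseBound, Real.sqrt_mul (by positivity), Real.sqrt_div zero_le_one, Real.sqrt_one]
  rw [hnb]
  refine (le_abs_self _).trans (Real.abs_le_sqrt ((hM _).2 ?_))
  rintro _ ⟨A, hA, rfl⟩
  have hA' : A ∈ M := hA
  set W := whitenedForm S X A
  have h0 : 1 / (n : ℝ) * W.trace ≤ aggTrace S X M :=
    le_sSup_image_finset M (fun A => 1 / (n : ℝ) * (whitenedForm S X A).trace) hA'
  have h1 : 1 / (n : ℝ) * opNorm W ≤ aggOp S X M :=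
    le_sSup_image_finset M (fun A => 1 / (n : ℝ) * opNorm (whitenedForm S X A)) hA'
  have h2 : 1 / (n : ℝ) * frobNorm W ≤ aggFrob S X M :=
    le_sSup_image_finset M (fun A => 1 / (n : ℝ) * frobNorm (whitenedForm S X A)) hA'
  -- The suprema over `M` are taken separately in the two entries, which needs `κ ≥ 0`.
  have hmax : 1 / (n : ℝ) * max (frobNorm W * Real.sqrt κ) (opNorm W * κ) ≤
      max (aggFrob S X M * Real.sqrt κ) (aggOp S X M * κ) := by
    rw [mul_max_of_nonneg _ _ (by positivity), ← mul_assoc, ← mul_assoc]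
    gcongr
  have hq : 1 / (n : ℝ) * quadForm A (Xᵀ *ᵥ x) ≤ T := by
    refine (mul_le_mul_of_nonneg_left (h A hA') (by positivity)).trans ?_
    have := mul_le_mul_of_nonneg_left hmax (by positivity : 0 ≤ 2 * η ^ 2)
    rw [mul_add]
    linarith
  -- Of the two factors `1 / n`, one enters the aggregates and the other becomes the `1 / √n` of
  -- `Λ`.
  calc quadForm A ((1 / (n : ℝ)) • (Xᵀ *ᵥ x))
      = 1 / (n : ℝ) * (1 / (n : ℝ) * quadForm A (Xᵀ *ᵥ x)) := by rw [quadForm_smul]; ring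
    _ ≤ 1 / (n : ℝ) * T := by gcongr

theorem mainTheorem2 :
    ∃ c : ℝ, 2 < c ∧ IsHansonWrightConstant.{u} c ∧
      ∀ (Ω : Type u) [MeasurableSpace Ω] (P : Measure Ω) [IsProbabilityMeasure P]
        (n p : ℕ) (_hn : 0 < n)
        -- the noise: mean zero, with an invertible covariance matrix
        (ε : Ω → EuclideanSpace ℝ (Fin n)) (_hε : Measurable ε)
        (_hε2 : ∀ i, MemLp (fun ω => ε ω i) 2 P)
        (_hmean : ∀ i, ∫ ω, ε ω i ∂P = 0)
        (_hcov : (covMatrix P ε).PosDef)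
        -- `Σ^{-1/2} ε` has the convex concentration property with constant at most `η`
        (η : ℝ)
        (_hccp : ∃ K ≤ η, HasConvexConcentration P
          (fun ω => WithLp.toLp 2 ((CFC.sqrt (covMatrix P ε))⁻¹ *ᵥ (ε ω).ofLp)) K)
        -- a norm on `ℝᵖ` whose squared dual is a supremum of finitely many quadratic forms
        (N : Seminorm ℝ (Fin p → ℝ)) (_hN : ∀ β, N β = 0 → β = 0)
        (M : Finset (Matrix (Fin p) (Fin p) ℝ))
        (_hM : ∀ β : Fin p → ℝ,
          IsLUB ((fun A => quadForm A β) '' (M : Set (Matrix (Fin p) (Fin p) ℝ)))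
            (dualNorm N β ^ 2))
        (X : Matrix (Fin n) (Fin p) ℝ)
        (p₀ : ℝ) (_hp₀ : 0 < p₀) (_hp₀' : p₀ < 1 / 2),
        1 - 2 * p₀ ≤
          P.real {ω | dualNorm N ((1 / (n : ℝ)) • (Xᵀ *ᵥ (ε ω).ofLp)) ≤
            noiseBound c η p₀ (covMatrix P ε) X M} := by
  refine ⟨163840000, by norm_num, isHansonWrightConstant_163840000, ?_⟩
  intro Ω _ P _ n p hn ε hε hε2 hmean hcov η hccp N _ M hM X p₀ hp₀ hp₀'
  set c : ℝ := 163840000 with hc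
  have hc0 : 0 < c := by rw [hc]; norm_num
  obtain ⟨K, hK, hv⟩ := hccp
  replace hv := hv.mono hK
  set S := covMatrix P ε
  set v : Ω → EuclideanSpace ℝ (Fin n) :=
    fun ω => WithLp.toLp 2 ((CFC.sqrt S)⁻¹ *ᵥ (ε ω).ofLp) with hvdef
  have hcoord : ∀ i, Measurable fun ω => ε ω i := fun i => by fun_prop
  have hvmeas : Measurable v := by
    refine (WithLp.measurable_toLp 2 _).comp (measurable_pi_lambda _ fun i => ?_)
    simp only [Matrix.mulVec, dotProduct]
    fun_prop
  have hvmean : ∀ i, ∫ ω, v ω i ∂P = 0 := by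
    intro i
    simp only [hvdef, Matrix.mulVec, dotProduct]
    rw [integral_finsetSum _ fun j _ => ((hε2 j).integrable one_le_two).const_mul _]
    simp [integral_const_mul, hmean]
  have hcard : 0 < M.card := by
    rw [Finset.card_pos, Finset.nonempty_iff_ne_empty]
    rintro rfl
    -- Every real number bounds the empty set, so an empty `M` would have no least upper bound.
    have := (hM 0).2 (show dualNorm N 0 ^ 2 - 1 ∈ _ by simp)
    linarith
  have hcard1 : (1 : ℝ) ≤ M.card := by exact_mod_cast hcard
  have hlog : 0 < Real.log ((M.card : ℝ) / p₀) := by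
    refine Real.log_pos ((one_lt_div hp₀).mpr (by linarith))
  have hκ : 0 < logTerm c p₀ M := by unfold logTerm; positivity
  -- The factor `c / 2` in `κ` cancels the Hanson–Wright constant.
  have hexp : Real.exp (-(1 / c * (2 * logTerm c p₀ M))) = p₀ / M.card := by
    have h1 : 1 / c * (2 * logTerm c p₀ M) = Real.log ((M.card : ℝ) / p₀) := by
      unfold logTerm; field_simp
    rw [h1, ← Real.log_inv, Real.exp_log (by positivity), inv_div]
  set bad : Matrix (Fin p) (Fin p) ℝ → Set Ω := fun A =>
    {ω | ∫ ω', quadForm (whitenedForm S X A) (v ω').ofLp ∂P +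
        2 * η ^ 2 * max (frobNorm (whitenedForm S X A) * Real.sqrt (logTerm c p₀ M))
          (opNorm (whitenedForm S X A) * logTerm c p₀ M) <
        quadForm (whitenedForm S X A) (v ω).ofLp} with hbad
  have hbadle : ∀ A ∈ M, P.real (bad A) ≤ 2 * (p₀ / M.card) := fun A _ => by
    rw [← hexp]
    exact isHansonWrightConstant_163840000.upper_deviation hc0 hvmeas hvmean hv _ hκ
  have hunion : P.real (⋃ A ∈ M, bad A) ≤ 2 * p₀ := by
    refine (measureReal_biUnion_finset_le M bad).trans ((Finset.sum_le_sum hbadle).trans_eq ?_)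
    rw [Finset.sum_const, nsmul_eq_mul]
    field_simp
  have htrace : ∀ A, ∫ ω, quadForm (whitenedForm S X A) (v ω).ofLp ∂P =
      (whitenedForm S X A).trace := by
    intro A
    simp only [hvdef, quadForm_whitenedForm hcov, quadForm_transpose_mulVec]
    rw [integral_quadForm_eq_trace hε2, trace_whitenedForm hcov]
  set good := {ω | dualNorm N ((1 / (n : ℝ)) • (Xᵀ *ᵥ (ε ω).ofLp)) ≤ noiseBound c η p₀ S X M}
  -- Covering the whole space and using subadditivity avoids any measurability of `good`.
  have hcover : (⋃ A ∈ M, bad A) ∪ good = Set.univ := by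
    refine Set.eq_univ_of_forall fun ω => or_iff_not_imp_left.mpr fun hω => ?_
    refine dualNorm_le_noiseBound hn hκ.le hM fun A hA => ?_
    simp only [Set.mem_iUnion, not_exists] at hω
    have h1 := hω A hA
    simp only [hbad, Set.mem_ofPred_eq, not_lt, htrace] at h1
    rwa [hvdef, quadForm_whitenedForm hcov] at h1
  have := measureReal_union_le (μ := P) (⋃ A ∈ M, bad A) good
  rw [hcover, probReal_univ] at this
  linarith
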